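/- Let $\mathbb K$ be a field, $n\ge 1$, and let $(\mathfrak g,[\cdot,\dots,\cdot],\alpha)$ be an $n$-ary multiplicative Hom-Nambu-Lie superalgebra over $\mathbb K$: $\mathfrak g=\mathfrak g_{\bar 0}\oplus\mathfrak g_{\bar 1}$ is a $\mathbb Z_2$-graded vector space, $\alpha:\mathfrak g\to\mathfrak g$ is an even linear map, and the bracket is $n$-linear such that, for homogeneous elements, $$|[x_1,\dots,x_n]|=|x_1|+\dots+|x_n|,\qquad [x_1,\dots,x_i,x_{i+1},\dots,x_n]=-(-1)^{|x_i||x_{i+1}|}[x_1,\dots,x_{i+1},x_i,\dots,x_n],$$ $$\alpha[x_1,\dots,x_n]=[\alpha(x_1),\dots,\alpha(x_n)],$$ $$[\alpha(x_1),\dots,\alpha(x_{n-1}),[y_1,\dots,y_n]]=\sum_{i=1}^n(-1)^{(|x_1|+\dots+|x_{n-1}|)(|y_1|+\dots+|y_{i-1}|)}[\alpha(y_1),\dots,\alpha(y_{i-1}),[x_1,\dots,x_{n-1},y_i],\alpha(y_{i+1}),\dots,\alpha(y_n)].$$ *Cohomology.* For $d\in\mathbb Z_2$ let $C^1(\mathfrak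 g,\mathfrak g)_d$ be the space of linear maps $h:\mathfrak g\to\mathfrak g$ of degree $d$ with $h\circ\alpha=\alpha\circ h$, and $C^2(\mathfrak g,\mathfrak g)_d$ the space of $n$-linear maps $f:\mathfrak g^n\to\mathfrak g$ of degree $d$ that are super skew-symmetric (as the bracket is) and satisfy $f(\alpha(x_1),\dots,\alpha(x_n))=\alpha(f(x_1,\dots,x_n))$. For homogeneous arguments and $h$, $f$ of degree $d$, put $$(\delta^1h)(x_1,\dots,x_n)=-h[x_1,\dots,x_n]+\sum_{i=1}^n(-1)^{d(|x_1|+\dots+|x_{i-1}|)}[x_1,\dots,h(x_i),\dots,x_n],$$ and, with $x=(x_1,\dots,x_{n-1})$ and $|x|=|x_1|+\dots+|x_{n-1}|$, $$(\delta^2f)(x_1,\dots,x_{n-1},y_1,\dots,y_n)=f(\alpha(x_1),\dots,\alpha(x_{n-1}),[y_1,\dots,y_n])+(-1)^{d|x|}[\alpha(x_1),\dots,\alpha(x_{n-1}),f(y_1,\dots,y_n)]$$ $$-\sum_{i=1}^n(-1)^{|x|(|y_1|+\dots+|y_{i-1}|)}f(\alpha(y_1),\dots,[x_1,\dots,x_{n-1},y_i],\dots,\alpha(y_n))$$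 $$-\sum_{i=1}^n(-1)^{(d+|x|)(|y_1|+\dots+|y_{i-1}|)}[\alpha(y_1),\dots,f(x_1,\dots,x_{n-1},y_i),\dots,\alpha(y_n)].$$ Let $Z^2(\mathfrak g,\mathfrak g)_d=\{f\in C^2(\mathfrak g,\mathfrak g)_d:\delta^2f=0\}$, $B^2(\mathfrak g,\mathfrak g)_d=\delta^1C^1(\mathfrak g,\mathfrak g)_d$ and $H^2(\mathfrak g,\mathfrak g)=\bigoplus_{d}Z^2(\mathfrak g,\mathfrak g)_d/B^2(\mathfrak g,\mathfrak g)_d$. *Deformations.* Let $\mathfrak g[[t]]$ be the $\mathbb K[[t]]$-module of formal series with coefficients in $\mathfrak g$, graded by $\mathfrak g[[t]]_d=\mathfrak g_d[[t]]$, with $\alpha$ acting coefficientwise. A (formal one-parameter) deformation of $\mathfrak g$ is a $\mathbb K[[t]]$-$n$-linear map $f_t=\sum_{p\ge0}f_pt^p:\mathfrak g[[t]]^n\to\mathfrak g[[t]]$ with $f_0=[\cdot,\dots,\cdot]$ such that $(\mathfrak g[[t]],f_t,\alpha)$ is again an $n$-ary multiplicative Hom-Nambu-Lie superalgebra (over $\mathbb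 K[[t]]$). The null deformation is the one with $f_p=0$ for all $p\ge1$. Deformations $f_t,f'_t$ are equivalent if there is an even $\mathbb K[[t]]$-linear automorphism $\Phi_t=\sum_{i\ge0}\varphi_it^i$ of $\mathfrak g[[t]]$ with $\varphi_0=\mathrm{id}_{\mathfrak g}$, $\varphi_i\circ\alpha=\alpha\circ\varphi_i$ for all $i$, and $\Phi_t(f_t(x_1,\dots,x_n))=f'_t(\Phi_t(x_1),\dots,\Phi_t(x_n))$. **Theorem.** If $H^2(\mathfrak g,\mathfrak g)=0$, then $\mathfrak g$ is analytically rigid: every deformation $f_t$ of $\mathfrak g$ is equivalent to the null deformation. -/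

import Mathlib

namespace HomNambuLie

open Finset
open scoped PowerSeries

/-! Arities are written `N + 1`, so that the tuples `x₁, …, xₙ₋₁` are functions on `Fin N`.
The parity group is `ZMod 2`; `x ∈ 𝒢 a` says that `x` is homogeneous of degree `a`, and the sign
`(-1)^a` with `a : ZMod 2` is the power `(-1 : ℤˣ) ^ a`. -/

section Structure

variable {R g : Type*} [CommRing R] [AddCommGroup g] [Module R g] {N : ℕ}

/-- The value `[x₁, …, xₙ₋₁, z]` of an `n`-linear map, i.e. the action `𝒳 · z` of the fundamental
object `𝒳 = x₁ ∧ … ∧ xₙ₋₁` on `z`. -/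
def act (br : MultilinearMap R (fun _ : Fin (N + 1) => g) g) (x : Fin N → g) (z : g) : g :=
  br (Fin.snoc (α := fun _ => g) x z)

/-- `|f(x₁, …, xₙ)| = d + |x₁| + … + |xₙ|`: the `n`-linear map `f` is homogeneous of degree `d`. -/
def IsHomogeneousMap (𝒢 : ZMod 2 → Submodule R g) (d : ZMod 2)
    (f : MultilinearMap R (fun _ : Fin (N + 1) => g) g) : Prop :=
  ∀ (a : Fin (N + 1) → ZMod 2) (x : Fin (N + 1) → g), (∀ i, x i ∈ 𝒢 (a i)) →
    f x ∈ 𝒢 (d + ∑ i, a i)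

/-- Super skew-symmetry: exchanging the neighbours `xᵢ, xᵢ₊₁` multiplies the value by
`-(-1)^{|xᵢ||xᵢ₊₁|}`. -/
def IsSuperSkew (𝒢 : ZMod 2 → Submodule R g)
    (f : MultilinearMap R (fun _ : Fin (N + 1) => g) g) : Prop :=
  ∀ (a : Fin (N + 1) → ZMod 2) (x : Fin (N + 1) → g), (∀ i, x i ∈ 𝒢 (a i)) →
    ∀ i : Fin N, f (x ∘ Equiv.swap i.castSucc i.succ) =
      -((-1 : ℤˣ) ^ (a i.castSucc * a i.succ) • f x)

/-- `(g, br, α)`, with `g` graded by `𝒢`, is an `(N + 1)`-ary multiplicative Hom-Nambu-Lie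
superalgebra over the commutative ring `R`. -/
structure IsMultHomNambuLieSuperalgebra (𝒢 : ZMod 2 → Submodule R g)
    (br : MultilinearMap R (fun _ : Fin (N + 1) => g) g) (α : g →ₗ[R] g) : Prop where
  internal : DirectSum.IsInternal 𝒢
  even_map : ∀ (d : ZMod 2) (x : g), x ∈ 𝒢 d → α x ∈ 𝒢 d
  even_bracket : IsHomogeneousMap 𝒢 0 br
  skew : IsSuperSkew 𝒢 br
  multiplicative : ∀ x : Fin (N + 1) → g, α (br x) = br (fun i => α (x i))
  /-- The Hom-Nambu identity: `[α(x₁), …, α(xₙ₋₁), [y₁, …, yₙ]]` is the sum over `i` of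
  `± [α(y₁), …, α(yᵢ₋₁), [x₁, …, xₙ₋₁, yᵢ], α(yᵢ₊₁), …, α(yₙ)]`, the sign being
  `(-1)^{(|x₁| + … + |xₙ₋₁|)(|y₁| + … + |yᵢ₋₁|)}`. -/
  hom_nambu : ∀ (a : Fin N → ZMod 2) (b : Fin (N + 1) → ZMod 2) (x : Fin N → g)
    (y : Fin (N + 1) → g), (∀ i, x i ∈ 𝒢 (a i)) → (∀ i, y i ∈ 𝒢 (b i)) →
    act br (fun i => α (x i)) (br y) =
      ∑ i : Fin (N + 1), (-1 : ℤˣ) ^ ((∑ j, a j) * ∑ j ∈ Iio i, b j) •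
        br (Function.update (fun j => α (y j)) i (act br x (y i)))

end Structure

section Cohomology

variable {K g : Type*} [Field K] [AddCommGroup g] [Module K g] {N : ℕ}

/-- The coboundary formula for a map `f(𝒳₁, …, 𝒳ₘ, z)` of degree `d` in `m` fundamental objects
`𝒳ᵢ = 𝒳ᵢ¹ ∧ … ∧ 𝒳ᵢⁿ⁻¹` and one vector, with values in `g`, evaluated at `(𝒳₁, …, 𝒳ₘ₊₁, z)`,
where `𝒳ᵢˢ` is homogeneous of degree `a i s`.  Here
`[𝒳, 𝒴]_α = ∑ₛ (-1)^{|𝒳|(|𝒴¹| + … + |𝒴ˢ⁻¹|)} α(𝒴¹) ∧ … ∧ 𝒳·𝒴ˢ ∧ … ∧ α(𝒴ⁿ⁻¹)`.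
Indices start at `0` in the code, so `(-1)^i` becomes `(-1)^(i+1)`, and `i.succAbove` enumerates
the indices other than `i`. -/
def coboundary (br : MultilinearMap K (fun _ : Fin (N + 1) => g) g) (α : g →ₗ[K] g) {m : ℕ}
    (d : ZMod 2) (f : (Fin m → Fin N → g) → g → g)
    (a : Fin (m + 1) → Fin N → ZMod 2) (X : Fin (m + 1) → Fin N → g) (z : g) : g :=
  (∑ i : Fin (m + 1), ∑ j ∈ Ioi i, (-1 : ℤˣ) ^ ((i : ℕ) + 1) •
      (-1 : ℤˣ) ^ ((∑ s, a i s) * ∑ l ∈ Ioo i j, ∑ s, a l s) •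
      ∑ s : Fin N, (-1 : ℤˣ) ^ ((∑ s', a i s') * ∑ s' ∈ Iio s, a j s') •
        f (fun l => if i.succAbove l = j
            then Function.update (fun s' => α (X j s')) s (act br (X i) (X j s))
            else fun s' => α (X (i.succAbove l) s')) (α z)) +
  (∑ i : Fin (m + 1), (-1 : ℤˣ) ^ ((i : ℕ) + 1) •
      (-1 : ℤˣ) ^ ((∑ s, a i s) * ∑ l ∈ Ioi i, ∑ s, a l s) •
        f (fun l s => α (X (i.succAbove l) s)) (act br (X i) z)) +
  (∑ i : Fin (m + 1), (-1 : ℤˣ) ^ (i : ℕ) •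
      (-1 : ℤˣ) ^ ((∑ s, a i s) * (d + ∑ l ∈ Iio i, ∑ s, a l s)) •
        act br (fun s => (α ^ m) (X i s)) (f (fun l => X (i.succAbove l)) z)) +
  (-1 : ℤˣ) ^ m • ∑ s : Fin N,
      (-1 : ℤˣ) ^ ((d + ∑ l : Fin m, ∑ s', a l.castSucc s') * ∑ s' ∈ Iio s, a (Fin.last m) s') •
        act br (Function.update (fun s' => (α ^ m) (X (Fin.last m) s')) s
          (f (fun l => X l.castSucc) (X (Fin.last m) s))) ((α ^ m) z)

theorem act_add (br : MultilinearMap K (fun _ : Fin (N + 1) => g) g) (x : Fin N → g) (z w : g) :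
    act br x (z + w) = act br x z + act br x w := by
  have h := br.map_update_add (Fin.snoc (α := fun _ => g) x 0) (Fin.last N) z w
  simpa [act, Fin.update_snoc_last] using h

theorem act_smul (br : MultilinearMap K (fun _ : Fin (N + 1) => g) g) (x : Fin N → g) (c : K)
    (z : g) : act br x (c • z) = c • act br x z := by
  have h := br.map_update_smul (Fin.snoc (α := fun _ => g) x 0) (Fin.last N) c z
  simpa [act, Fin.update_snoc_last] using h

theorem act_update_add (br : MultilinearMap K (fun _ : Fin (N + 1) => g) g) (x : Fin N → g)
    (s : Fin N) (u v z : g) : act br (Function.update x s (u + v)) z =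
      act br (Function.update x s u) z + act br (Function.update x s v) z := by
  simp [act, Fin.snoc_update]

theorem act_update_smul (br : MultilinearMap K (fun _ : Fin (N + 1) => g) g) (x : Fin N → g)
    (s : Fin N) (c : K) (u z : g) : act br (Function.update x s (c • u)) z =
      c • act br (Function.update x s u) z := by
  simp [act, Fin.snoc_update]

theorem coboundary_add (br : MultilinearMap K (fun _ : Fin (N + 1) => g) g) (α : g →ₗ[K] g)
    {m : ℕ} (d : ZMod 2) (f f' : (Fin m → Fin N → g) → g → g)
    (a : Fin (m + 1) → Fin N → ZMod 2) (X : Fin (m + 1) → Fin N → g) (z : g) :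
    coboundary br α d (fun Y w => f Y w + f' Y w) a X z =
      coboundary br α d f a X z + coboundary br α d f' a X z := by
  simp only [coboundary, act_add, act_update_add, smul_add, Finset.sum_add_distrib]
  abel

theorem coboundary_smul (br : MultilinearMap K (fun _ : Fin (N + 1) => g) g) (α : g →ₗ[K] g)
    {m : ℕ} (d : ZMod 2) (c : K) (f : (Fin m → Fin N → g) → g → g)
    (a : Fin (m + 1) → Fin N → ZMod 2) (X : Fin (m + 1) → Fin N → g) (z : g) :
    coboundary br α d (fun Y w => c • f Y w) a X z = c • coboundary br α d f a X z := by
  simp only [coboundary, act_smul, act_update_smul, smul_add, Finset.smul_sum, smul_comm c]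

/-- `C¹(g, g)_d`: the linear maps `g → g` of degree `d` commuting with `α`. -/
def C1 (𝒢 : ZMod 2 → Submodule K g) (α : g →ₗ[K] g) (d : ZMod 2) : Submodule K (g →ₗ[K] g) where
  carrier := {h | (∀ (a : ZMod 2) (x : g), x ∈ 𝒢 a → h x ∈ 𝒢 (d + a)) ∧ ∀ x, h (α x) = α (h x)}
  zero_mem' := ⟨fun a _ _ => (𝒢 (d + a)).zero_mem, fun x => by simp⟩
  add_mem' := fun hf hf' =>
    ⟨fun a x hx => (𝒢 (d + a)).add_mem (hf.1 a x hx) (hf'.1 a x hx),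
      fun x => by simp [hf.2 x, hf'.2 x]⟩
  smul_mem' := fun c _ hf =>
    ⟨fun a x hx => (𝒢 (d + a)).smul_mem c (hf.1 a x hx), fun x => by simp [hf.2 x]⟩

/-- `C²(g, g)_d`: the super skew-symmetric `n`-linear maps `g × … × g → g` of degree `d`
commuting with `α`, i.e. maps of one fundamental object and one vector. -/
def C2 (N : ℕ) (𝒢 : ZMod 2 → Submodule K g) (α : g →ₗ[K] g) (d : ZMod 2) :
    Submodule K (MultilinearMap K (fun _ : Fin (N + 1) => g) g) where
  carrier := {f | IsHomogeneousMap 𝒢 d f ∧ IsSuperSkew 𝒢 f ∧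
    ∀ x : Fin (N + 1) → g, f (fun i => α (x i)) = α (f x)}
  zero_mem' := ⟨fun a _ _ => (𝒢 (d + ∑ i, a i)).zero_mem, fun _ _ _ _ => by simp,
    fun x => by simp⟩
  add_mem' := fun hf hf' =>
    ⟨fun a x hx => (𝒢 (d + ∑ i, a i)).add_mem (hf.1 a x hx) (hf'.1 a x hx),
      fun a x hx i => by
        simp only [add_apply, hf.2.1 a x hx i, hf'.2.1 a x hx i, smul_add, neg_add],
      fun x => by simp [hf.2.2 x, hf'.2.2 x]⟩
  smul_mem' := fun c _ hf =>
    ⟨fun a x hx => (𝒢 (d + ∑ i, a i)).smul_mem c (hf.1 a x hx),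
      fun a x hx i => by
        simp only [smul_apply, hf.2.1 a x hx i, smul_neg, smul_comm c],
      fun x => by simp [hf.2.2 x]⟩

/-- `Z²(g, g)_d`: the `f ∈ C²(g, g)_d` whose coboundary vanishes. -/
def Z2 (𝒢 : ZMod 2 → Submodule K g) (br : MultilinearMap K (fun _ : Fin (N + 1) => g) g)
    (α : g →ₗ[K] g) (d : ZMod 2) :
    Submodule K (MultilinearMap K (fun _ : Fin (N + 1) => g) g) where
  carrier := {f | f ∈ C2 N 𝒢 α d ∧
    ∀ (a : Fin 2 → Fin N → ZMod 2) (b : ZMod 2) (X : Fin 2 → Fin N → g) (z : g),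
      (∀ i s, X i s ∈ 𝒢 (a i s)) → z ∈ 𝒢 b →
        coboundary br α d (fun (Y : Fin 1 → Fin N → g) w => act f (Y 0) w) a X z = 0}
  zero_mem' := ⟨(C2 N 𝒢 α d).zero_mem, fun a _ X z _ _ => by
    simpa [act] using coboundary_smul br α d 0 (fun (_ : Fin 1 → Fin N → g) _ => (0 : g)) a X z⟩
  add_mem' := fun {f f'} hf hf' => ⟨(C2 N 𝒢 α d).add_mem hf.1 hf'.1, fun a b X z hX hz =>
    (coboundary_add br α d (fun (Y : Fin 1 → Fin N → g) w => act f (Y 0) w)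
      (fun Y w => act f' (Y 0) w) a X z).trans
      (by rw [hf.2 a b X z hX hz, hf'.2 a b X z hX hz, add_zero])⟩
  smul_mem' := fun c f hf => ⟨(C2 N 𝒢 α d).smul_mem c hf.1, fun a b X z hX hz =>
    (coboundary_smul br α d c (fun (Y : Fin 1 → Fin N → g) w => act f (Y 0) w) a X z).trans
      (by rw [hf.2 a b X z hX hz, smul_zero])⟩

/-- `B²(g, g)_d`: the `f ∈ C²(g, g)_d` that are the coboundary of some `h ∈ C¹(g, g)_d`. -/
def B2 (𝒢 : ZMod 2 → Submodule K g) (br : MultilinearMap K (fun _ : Fin (N + 1) => g) g)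
    (α : g →ₗ[K] g) (d : ZMod 2) :
    Submodule K (MultilinearMap K (fun _ : Fin (N + 1) => g) g) where
  carrier := {f | f ∈ C2 N 𝒢 α d ∧ ∃ h ∈ C1 𝒢 α d,
    ∀ (a : Fin 1 → Fin N → ZMod 2) (b : ZMod 2) (X : Fin 1 → Fin N → g) (z : g),
      (∀ i s, X i s ∈ 𝒢 (a i s)) → z ∈ 𝒢 b →
        act f (X 0) z = coboundary br α d (fun (_ : Fin 0 → Fin N → g) w => h w) a X z}
  zero_mem' := ⟨(C2 N 𝒢 α d).zero_mem, 0, (C1 𝒢 α d).zero_mem, fun a _ X z _ _ => by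
    simpa [act] using
      (coboundary_smul br α d 0 (fun (_ : Fin 0 → Fin N → g) _ => (0 : g)) a X z).symm⟩
  add_mem' := by
    rintro f f' ⟨hf, h, hh, H⟩ ⟨hf', h', hh', H'⟩
    refine ⟨(C2 N 𝒢 α d).add_mem hf hf', h + h', (C1 𝒢 α d).add_mem hh hh',
      fun a b X z hX hz => ?_⟩
    refine Eq.trans ?_ (coboundary_add br α d (fun (_ : Fin 0 → Fin N → g) w => h w)
      (fun _ w => h' w) a X z).symm
    rw [← H a b X z hX hz, ← H' a b X z hX hz]
    rfl
  smul_mem' := by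
    rintro c f ⟨hf, h, hh, H⟩
    refine ⟨(C2 N 𝒢 α d).smul_mem c hf, c • h, (C1 𝒢 α d).smul_mem c hh,
      fun a b X z hX hz => ?_⟩
    refine Eq.trans ?_ (coboundary_smul br α d c (fun (_ : Fin 0 → Fin N → g) w => h w)
      a X z).symm
    rw [← H a b X z hX hz]
    rfl

/-- The degree `d` part of the cohomology space, `H²(g, g)_d = Z²(g, g)_d / B²(g, g)_d`. -/
abbrev H2Part (𝒢 : ZMod 2 → Submodule K g)
    (br : MultilinearMap K (fun _ : Fin (N + 1) => g) g) (α : g →ₗ[K] g) (d : ZMod 2) :=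
  Z2 𝒢 br α d ⧸ (B2 𝒢 br α d).submoduleOf (Z2 𝒢 br α d)

/-- The graded space `H²(g, g) = H²(g, g)_0 ⊕ H²(g, g)_1`. -/
abbrev H2 (𝒢 : ZMod 2 → Submodule K g)
    (br : MultilinearMap K (fun _ : Fin (N + 1) => g) g) (α : g →ₗ[K] g) :=
  (d : ZMod 2) → H2Part 𝒢 br α d

end Cohomology

section FormalSeries

variable {K g : Type*} [Field K] [AddCommGroup g] [Module K g] {N : ℕ}

/-- `g[[t]]`: the formal series `∑ₖ xₖ tᵏ` with coefficients `xₖ` in `g`. -/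
def FormalSeries (g : Type*) : Type _ := ℕ → g

namespace FormalSeries

/-- The coefficient of `tᵏ`. -/
def coeff {g : Type*} (k : ℕ) (x : FormalSeries g) : g := x k

/-- An element of `g` as a constant series. -/
def const (x : g) : FormalSeries g := fun k => if k = 0 then x else 0

theorem ext {g : Type*} {x y : FormalSeries g} (h : ∀ k, coeff k x = coeff k y) : x = y := funext h

instance : AddCommGroup (FormalSeries g) := inferInstanceAs (AddCommGroup (ℕ → g))

/-- `(∑ᵢ cᵢ tⁱ) • (∑ⱼ xⱼ tʲ) = ∑ₖ (∑_{i+j=k} cᵢ xⱼ) tᵏ`. -/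
noncomputable instance : SMul K⟦X⟧ (FormalSeries g) :=
  ⟨fun c x k => ∑ p ∈ antidiagonal k, PowerSeries.coeff p.1 c • x p.2⟩

theorem coeff_add (k : ℕ) (x y : FormalSeries g) : coeff k (x + y) = coeff k x + coeff k y := rfl

theorem coeff_zero (k : ℕ) : coeff k (0 : FormalSeries g) = 0 := rfl

theorem coeff_smul (k : ℕ) (c : K⟦X⟧) (x : FormalSeries g) :
    coeff k (c • x) = ∑ p ∈ antidiagonal k, PowerSeries.coeff p.1 c • coeff p.2 x := rfl

noncomputable instance : Module K⟦X⟧ (FormalSeries g) where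
  one_smul x := ext fun k => by
    rw [coeff_smul, Finset.sum_eq_single (0, k)]
    · simp
    · rintro ⟨i, j⟩ hij hne
      have : i ≠ 0 := by
        rintro rfl
        exact hne (by simpa using hij)
      simp [PowerSeries.coeff_one, this]
    · simp
  mul_smul c c' x := ext fun k => by
    simp only [coeff_smul, PowerSeries.coeff_mul, Finset.sum_smul, Finset.smul_sum, mul_smul]
    rw [Finset.sum_sigma', Finset.sum_sigma']
    refine Finset.sum_nbij' (fun p => ⟨(p.2.1, p.2.2 + p.1.2), (p.2.2, p.1.2)⟩)
      (fun p => ⟨(p.1.1 + p.2.1, p.2.2), (p.1.1, p.2.1)⟩) ?_ ?_ ?_ ?_ (fun _ _ => rfl) <;>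
    · rintro ⟨⟨i, j⟩, ⟨i', j'⟩⟩ h
      simp only [Finset.mem_sigma, HasAntidiagonal.mem_antidiagonal] at h ⊢
      first
        | omega
        | (obtain ⟨rfl, rfl⟩ := h; simp [add_assoc])
  smul_zero c := ext fun k => by simp [coeff_smul, coeff_zero]
  smul_add c x y := ext fun k => by
    simp [coeff_smul, coeff_add, Finset.sum_add_distrib]
  add_smul c c' x := ext fun k => by
    simp [coeff_smul, coeff_add, add_smul, Finset.sum_add_distrib]
  zero_smul x := ext fun k => by simp [coeff_smul, coeff_zero]

/-- A linear map acting on series coefficientwise. -/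
noncomputable def mapLin (α : g →ₗ[K] g) : FormalSeries g →ₗ[K⟦X⟧] FormalSeries g where
  toFun x k := α (coeff k x)
  map_add' x y := ext fun k => α.map_add (coeff k x) (coeff k y)
  map_smul' c x := ext fun k => by
    change α (∑ p ∈ antidiagonal k, PowerSeries.coeff p.1 c • coeff p.2 x) =
      ∑ p ∈ antidiagonal k, PowerSeries.coeff p.1 c • α (coeff p.2 x)
    simp only [map_sum, map_smul]

/-- The grading `g[[t]]_d = g_d[[t]]`. -/
def grading (𝒢 : ZMod 2 → Submodule K g) (d : ZMod 2) : Submodule K⟦X⟧ (FormalSeries g) where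
  carrier := {x | ∀ k, coeff k x ∈ 𝒢 d}
  zero_mem' := fun _ => (𝒢 d).zero_mem
  add_mem' := fun hx hy k => (𝒢 d).add_mem (hx k) (hy k)
  smul_mem' := fun c x hx k => by
    rw [coeff_smul]
    exact (𝒢 d).sum_mem fun p _ => (𝒢 d).smul_mem _ (hx p.2)

end FormalSeries

open FormalSeries

/-- `f_t` is a deformation of `(g, br, α)`: a `K[[t]]`-`n`-linear map on `g[[t]]` such that
`(g[[t]], f_t, α)` is a multiplicative Hom-Nambu-Lie superalgebra and `f₀ = br`.
Such a map is automatically of the form `∑ₚ fₚ tᵖ`, the `n`-linear map `fₚ` on `g` being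
`x ↦ coeff p (f_t x)` for constant series `x`. -/
structure IsDeformation (𝒢 : ZMod 2 → Submodule K g)
    (br : MultilinearMap K (fun _ : Fin (N + 1) => g) g) (α : g →ₗ[K] g)
    (f : MultilinearMap K⟦X⟧ (fun _ : Fin (N + 1) => FormalSeries g) (FormalSeries g)) :
    Prop where
  superalgebra : IsMultHomNambuLieSuperalgebra (grading 𝒢) f (mapLin α)
  coeff_zero : ∀ x : Fin (N + 1) → g, coeff 0 (f fun i => const (x i)) = br x

/-- The null deformation: `f₁ = f₂ = … = 0`. -/
def IsNullDeformation (𝒢 : ZMod 2 → Submodule K g)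
    (br : MultilinearMap K (fun _ : Fin (N + 1) => g) g) (α : g →ₗ[K] g)
    (f : MultilinearMap K⟦X⟧ (fun _ : Fin (N + 1) => FormalSeries g) (FormalSeries g)) : Prop :=
  IsDeformation 𝒢 br α f ∧
    ∀ p, 1 ≤ p → ∀ x : Fin (N + 1) → g, coeff p (f fun i => const (x i)) = 0

/-- Equivalence `f_t ∼ f'_t`: an even isomorphism `Φ_t = ∑ᵢ φᵢ tⁱ` from `(g[[t]], f_t, α)` to
`(g[[t]], f'_t, α)` with `φ₀ = id`, where `φᵢ x = coeff i (Φ_t x)` for constant `x`. -/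
def Equivalent (𝒢 : ZMod 2 → Submodule K g) (α : g →ₗ[K] g)
    (f f' : MultilinearMap K⟦X⟧ (fun _ : Fin (N + 1) => FormalSeries g) (FormalSeries g)) :
    Prop :=
  ∃ Φ : FormalSeries g ≃ₗ[K⟦X⟧] FormalSeries g,
    (∀ (d : ZMod 2) (x : FormalSeries g), x ∈ grading 𝒢 d → Φ x ∈ grading 𝒢 d) ∧
    (∀ x : g, coeff 0 (Φ (const x)) = x) ∧
    (∀ x, Φ (mapLin α x) = mapLin α (Φ x)) ∧
    ∀ x : Fin (N + 1) → FormalSeries g, Φ (f x) = f' fun i => Φ (x i)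

/-- Analytic rigidity: every deformation is equivalent to the null deformation. -/
def AnalyticallyRigid (𝒢 : ZMod 2 → Submodule K g)
    (br : MultilinearMap K (fun _ : Fin (N + 1) => g) g) (α : g →ₗ[K] g) : Prop :=
  ∀ f : MultilinearMap K⟦X⟧ (fun _ : Fin (N + 1) => FormalSeries g) (FormalSeries g),
    IsDeformation 𝒢 br α f →
      ∃ f₀ : MultilinearMap K⟦X⟧ (fun _ : Fin (N + 1) => FormalSeries g) (FormalSeries g),
        IsNullDeformation 𝒢 br α f₀ ∧ Equivalent 𝒢 α f f₀

end FormalSeries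

end HomNambuLie

/-!
The rigidity argument kills the coefficients of a deformation one after the other.

Suppose `f_t = br + fₚ tᵖ + …` with `p ≥ 1`. The coefficient of `tᵖ` in the Hom-Nambu identity for
`f_t` is `δ²fₚ = 0` (`IsTrivialBelow.coeffMap_mem_Z2`), and `fₚ` has degree `0`. Since
`H²(g, g)_0 = 0`, there is an even `h` commuting with `α` such that `fₚ = δ¹h`. Conjugating `f_t` by
`1 + tᵖ h` changes nothing below `tᵖ` and replaces `fₚ` by `fₚ - δ¹h = 0`
(`IsTrivialBelow.coeff_transport`, `IsTrivialBelow.exists_gauge`).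

The automorphisms obtained up to stage `n` form a sequence that is constant modulo growing powers
of `t`, so it has a `t`-adic limit (`exists_limit_gauge`). The limit is invertible because it is the
identity modulo `t` (`IsGauge.bijective`), and conjugating `f_t` by it gives a deformation with no
coefficient beyond the constant one. That the result is a superalgebra over `K[[t]]` is inherited
from `f_t` by transport of structure (`isMultHomNambuLieSuperalgebra_transport`), so the
`K[[t]]`-linear extension of `br` never has to be constructed.
All estimates are congruences modulo `tᵖ` (`CongrMod`), which `K[[t]]`-multilinear maps preserve.
-/

namespace HomNambuLie

open Finset FormalSeries
open scoped PowerSeries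

variable {K g : Type*} [Field K] [AddCommGroup g] [Module K g] {N : ℕ}

/-! ### The `t`-adic filtration of `g[[t]]` -/

namespace FormalSeries

theorem coeff_neg (k : ℕ) (x : FormalSeries g) : coeff k (-x) = -coeff k x := rfl

theorem coeff_sub (k : ℕ) (x y : FormalSeries g) :
    coeff k (x - y) = coeff k x - coeff k y := rfl

theorem coeff_sum {ι : Type*} (k : ℕ) (s : Finset ι) (x : ι → FormalSeries g) :
    coeff k (∑ i ∈ s, x i) = ∑ i ∈ s, coeff k (x i) :=
  map_sum (⟨⟨coeff k, rfl⟩, fun _ _ => rfl⟩ : FormalSeries g →+ g) x s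

theorem coeff_units_smul (k : ℕ) (u : ℤˣ) (x : FormalSeries g) :
    coeff k (u • x) = u • coeff k x := by
  rcases Int.units_eq_one_or u with rfl | rfl
  · simp
  · simp [coeff_neg]

theorem coeff_C_smul (k : ℕ) (c : K) (x : FormalSeries g) :
    coeff k (PowerSeries.C c • x) = c • coeff k x := by
  rw [coeff_smul, Finset.sum_eq_single (0, k)]
  · simp
  · rintro ⟨i, j⟩ hij hne
    have : i ≠ 0 := by
      rintro rfl
      exact hne (by simpa using hij)
    simp [PowerSeries.coeff_C, this]
  · simp

theorem coeff_X_pow_smul (k p : ℕ) (x : FormalSeries g) :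
    coeff k ((PowerSeries.X : K⟦X⟧) ^ p • x) = if p ≤ k then coeff (k - p) x else 0 := by
  rw [coeff_smul]
  split_ifs with h
  · rw [Finset.sum_eq_single (p, k - p)]
    · simp
    · rintro ⟨i, j⟩ hij hne
      have : i ≠ p := by
        rintro rfl
        refine hne (Prod.ext rfl ?_)
        have := HasAntidiagonal.mem_antidiagonal.1 hij
        simp only at this ⊢
        omega
      simp [PowerSeries.coeff_X_pow, this]
    · intro hn
      exact absurd (HasAntidiagonal.mem_antidiagonal.2 (by simp only; omega)) hn
  · refine Finset.sum_eq_zero fun q hq => ?_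
    have := HasAntidiagonal.mem_antidiagonal.1 hq
    rw [PowerSeries.coeff_X_pow, if_neg (by omega), zero_smul]

theorem coeff_mapLin (k : ℕ) (h : g →ₗ[K] g) (x : FormalSeries g) :
    coeff k (mapLin h x) = h (coeff k x) := rfl

theorem coeff_const (k : ℕ) (x : g) : coeff k (const x) = if k = 0 then x else 0 := rfl

theorem coeff_zero_const (x : g) : coeff 0 (const x) = x := rfl

theorem const_add (x y : g) : const (x + y) = const x + const y :=
  ext fun k => by simp only [coeff_add, coeff_const]; split_ifs <;> simp

theorem const_smul (c : K) (x : g) : const (c • x) = PowerSeries.C c • const x :=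
  ext fun k => by simp only [coeff_C_smul, coeff_const]; split_ifs <;> simp

theorem mapLin_const (h : g →ₗ[K] g) (x : g) : mapLin h (const x) = const (h x) :=
  ext fun k => by simp only [coeff_mapLin, coeff_const]; split_ifs <;> simp

theorem const_mem_grading {𝒢 : ZMod 2 → Submodule K g} {d : ZMod 2} {x : g} (hx : x ∈ 𝒢 d) :
    const x ∈ grading 𝒢 d := fun k => by
  rw [coeff_const]; split_ifs
  exacts [hx, (𝒢 d).zero_mem]

theorem const_update {ι : Type*} [DecidableEq ι] (x : ι → g) (i : ι) (v : g) :
    (fun j => const (Function.update x i v j)) =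
      Function.update (fun j => const (x j)) i (const v) :=
  funext fun j => Function.apply_update (fun _ => const) x i v j

/-- Congruence modulo `tᵖ` in `g[[t]]`: the coefficients of `t⁰, …, tᵖ⁻¹` agree. -/
def CongrMod (p : ℕ) (x y : FormalSeries g) : Prop := ∀ k < p, coeff k x = coeff k y

namespace CongrMod

variable {p : ℕ} {x y x' y' : FormalSeries g}

theorem refl {g : Type*} (p : ℕ) (x : FormalSeries g) : CongrMod p x x := fun _ _ => rfl

theorem symm {g : Type*} {x y : FormalSeries g} (h : CongrMod p x y) : CongrMod p y x :=
  fun k hk => (h k hk).symm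

theorem trans {g : Type*} {x y z : FormalSeries g} (h : CongrMod p x y)
    (h' : CongrMod p y z) : CongrMod p x z :=
  fun k hk => (h k hk).trans (h' k hk)

theorem mono {g : Type*} {x y : FormalSeries g} {q : ℕ} (hqp : q ≤ p)
    (h : CongrMod p x y) : CongrMod q x y :=
  fun k hk => h k (hk.trans_le hqp)

theorem add (h : CongrMod p x y) (h' : CongrMod p x' y') : CongrMod p (x + x') (y + y') :=
  fun k hk => by rw [coeff_add, coeff_add, h k hk, h' k hk]

theorem exists_eq_add (h : CongrMod p x y) :
    ∃ z, x = y + (PowerSeries.X : K⟦X⟧) ^ p • z := by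
  let z : FormalSeries g := fun k => coeff (k + p) (x - y)
  refine ⟨z, ext fun k => ?_⟩
  rw [coeff_add, coeff_X_pow_smul]
  split_ifs with hk
  · change coeff k x = coeff k y + coeff (k - p + p) (x - y)
    rw [Nat.sub_add_cancel hk, coeff_sub]
    abel
  · rw [h k (by omega), add_zero]

theorem add_X_pow_smul (p : ℕ) (x z : FormalSeries g) :
    CongrMod p (x + (PowerSeries.X : K⟦X⟧) ^ p • z) x := fun k hk => by
  rw [coeff_add, coeff_X_pow_smul, if_neg (by omega), add_zero]

theorem X_pow_smul (q : ℕ) (h : CongrMod p x y) :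
    CongrMod (p + q) ((PowerSeries.X : K⟦X⟧) ^ q • x) ((PowerSeries.X : K⟦X⟧) ^ q • y) := by
  intro k hk
  rw [coeff_X_pow_smul, coeff_X_pow_smul]
  split_ifs
  · exact h _ (by omega)
  · rfl

theorem map (L : FormalSeries g →ₗ[K⟦X⟧] FormalSeries g) (h : CongrMod p x y) :
    CongrMod p (L x) (L y) := by
  obtain ⟨z, rfl⟩ := h.exists_eq_add (K := K)
  rw [map_add, map_smul]
  exact add_X_pow_smul p _ _

theorem map_multilinear {ι : Type*} [Fintype ι] [DecidableEq ι]
    (f : MultilinearMap K⟦X⟧ (fun _ : ι => FormalSeries g) (FormalSeries g))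
    {x y : ι → FormalSeries g} (h : ∀ i, CongrMod p (x i) (y i)) : CongrMod p (f x) (f y) := by
  suffices H : ∀ s : Finset ι, CongrMod p (f (s.piecewise x y)) (f y) by
    simpa using H univ
  intro s
  induction s using Finset.induction_on with
  | empty => simpa using refl p _
  | insert a s ha ih =>
    obtain ⟨z, hz⟩ := (h a).exists_eq_add (K := K)
    rw [Finset.piecewise_insert, hz, f.map_update_add, f.map_update_smul]
    refine (add_X_pow_smul p _ _).trans ?_
    rwa [← Finset.piecewise_eq_of_notMem s x y ha, Function.update_eq_self]

end CongrMod

/-- First order expansion `f(xᵢ + tᵖ yᵢ) ≡ f(x) + tᵖ ∑ᵢ f(x₁, …, yᵢ, …, xₙ)` modulo `t²ᵖ`. -/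
theorem congrMod_map_add_X_pow_smul {ι : Type*} [Fintype ι] [DecidableEq ι]
    (f : MultilinearMap K⟦X⟧ (fun _ : ι => FormalSeries g) (FormalSeries g)) (p : ℕ)
    (x y : ι → FormalSeries g) :
    CongrMod (p + p) (f fun i => x i + (PowerSeries.X : K⟦X⟧) ^ p • y i)
      (f x + (PowerSeries.X : K⟦X⟧) ^ p • ∑ i, f (Function.update x i (y i))) := by
  set w : ι → FormalSeries g := fun i => x i + (PowerSeries.X : K⟦X⟧) ^ p • y i with hw
  suffices H : ∀ s : Finset ι, CongrMod (p + p) (f (s.piecewise w x))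
      (f x + (PowerSeries.X : K⟦X⟧) ^ p • ∑ i ∈ s, f (Function.update x i (y i))) by
    simpa using H univ
  intro s
  induction s using Finset.induction_on with
  | empty => simpa using CongrMod.refl _ _
  | insert a s ha ih =>
    rw [Finset.piecewise_insert, hw, f.map_update_add, f.map_update_smul, ← hw,
      Finset.sum_insert ha, smul_add, add_comm ((PowerSeries.X : K⟦X⟧) ^ p • _), ← add_assoc]
    refine CongrMod.add ?_ (CongrMod.X_pow_smul p (CongrMod.map_multilinear f fun i => ?_))
    · rwa [← Finset.piecewise_eq_of_notMem s w x ha, Function.update_eq_self]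
    · by_cases hi : i = a
      · subst hi; simpa using CongrMod.refl _ _
      · rw [Function.update_of_ne hi, Function.update_of_ne hi]
        by_cases his : i ∈ s
        · rw [Finset.piecewise_eq_of_mem _ _ _ his]
          exact CongrMod.add_X_pow_smul p _ _
        · rw [Finset.piecewise_eq_of_notMem _ _ _ his]
          exact CongrMod.refl _ _

end FormalSeries

/-! ### Even automorphisms of `g[[t]]` that are the identity modulo `t` -/

/-- The maps admitted as equivalences of deformations: even `K[[t]]`-linear endomorphisms of
`g[[t]]` that commute with `α` and are congruent to the identity modulo `t`. -/
structure IsGauge (𝒢 : ZMod 2 → Submodule K g) (α : g →ₗ[K] g)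
    (Φ : FormalSeries g →ₗ[K⟦X⟧] FormalSeries g) : Prop where
  even : ∀ (d : ZMod 2) (x : FormalSeries g), x ∈ grading 𝒢 d → Φ x ∈ grading 𝒢 d
  comm : ∀ x, Φ (mapLin α x) = mapLin α (Φ x)
  congr_id : ∀ x, CongrMod 1 (Φ x) x

namespace IsGauge

variable {𝒢 : ZMod 2 → Submodule K g} {α : g →ₗ[K] g}
  {Φ Ψ : FormalSeries g →ₗ[K⟦X⟧] FormalSeries g}

theorem comp (hΦ : IsGauge 𝒢 α Φ) (hΨ : IsGauge 𝒢 α Ψ) : IsGauge 𝒢 α (Φ ∘ₗ Ψ) where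
  even d x hx := hΦ.even d _ (hΨ.even d x hx)
  comm x := by simp only [LinearMap.comp_apply, hΨ.comm, hΦ.comm]
  congr_id x := (hΦ.congr_id _).trans (hΨ.congr_id x)

/-- `Φ - 1` is a contraction: it sends a congruence modulo `tᵖ` to one modulo `tᵖ⁺¹`. -/
theorem congrMod_sub (hΦ : IsGauge 𝒢 α Φ) {p : ℕ} {x y : FormalSeries g} (h : CongrMod p x y) :
    CongrMod (p + 1) (Φ x - x) (Φ y - y) := by
  obtain ⟨z, rfl⟩ := h.exists_eq_add (K := K)
  have key := (hΦ.congr_id z).X_pow_smul (K := K) p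
  intro k hk
  have := key k (by omega)
  simp only [map_add, map_smul, coeff_sub, coeff_add, this]
  abel

theorem injective (hΦ : IsGauge 𝒢 α Φ) : Function.Injective Φ := by
  intro x y hxy
  have H : ∀ p, CongrMod p x y := by
    intro p
    induction p with
    | zero => exact fun k hk => absurd hk (by omega)
    | succ p ih =>
      intro k hk
      simpa [coeff_sub, hxy] using hΦ.congrMod_sub ih k hk
  exact ext fun k => H (k + 1) k (by omega)

/-- The preimage of `y` is the limit of the iteration `x ↦ y - (Φ x - x)`, which stays inside
`g_d[[t]]` when `y` lies there. -/
theorem exists_preimage (hΦ : IsGauge 𝒢 α Φ) (y : FormalSeries g) :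
    ∃ x, Φ x = y ∧ ∀ d, y ∈ grading 𝒢 d → x ∈ grading 𝒢 d := by
  let u : ℕ → FormalSeries g := Nat.rec y fun _ x => y - (Φ x - x)
  have hu : ∀ n, u (n + 1) = y - (Φ (u n) - u n) := fun _ => rfl
  have hstep : ∀ n, CongrMod (n + 1) (u (n + 1)) (u n) := by
    intro n
    induction n with
    | zero =>
      intro k hk
      have := hΦ.congr_id y k hk
      change coeff k (y - (Φ y - y)) = coeff k y
      simp [coeff_sub, this]
    | succ n ih =>
      intro k hk
      rw [hu (n + 1), hu n, coeff_sub, hΦ.congrMod_sub ih k hk, ← coeff_sub]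
  have hmono : ∀ n m, CongrMod (n + 1) (u (n + m)) (u n) := by
    intro n m
    induction m with
    | zero => exact CongrMod.refl _ _
    | succ m ih => exact ((hstep (n + m)).mono (by omega)).trans ih
  let x : FormalSeries g := fun k => coeff k (u k)
  have hx : ∀ n, CongrMod (n + 1) x (u n) := by
    intro n k hk
    obtain ⟨m, rfl⟩ := Nat.exists_eq_add_of_le (Nat.lt_succ_iff.1 hk)
    exact (hmono k m k (by omega)).symm
  refine ⟨x, ext fun k => ?_, fun d hy k => ?_⟩
  · have h1 := hx (k + 1) k (by omega)
    rw [hu, coeff_sub, ← hΦ.congrMod_sub (hx k) k (by omega), coeff_sub] at h1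
    simpa using eq_sub_iff_add_eq.1 h1
  · suffices H : ∀ n, u n ∈ grading 𝒢 d from H k k
    intro n
    induction n with
    | zero => exact hy
    | succ n ih => exact sub_mem hy (sub_mem (hΦ.even d _ ih) ih)

theorem bijective (hΦ : IsGauge 𝒢 α Φ) : Function.Bijective Φ :=
  ⟨hΦ.injective, fun y => (hΦ.exists_preimage y).imp fun _ h => h.1⟩

theorem symm_even {E : FormalSeries g ≃ₗ[K⟦X⟧] FormalSeries g} (hE : IsGauge 𝒢 α E.toLinearMap)
    {d : ZMod 2} {x : FormalSeries g} (hx : x ∈ grading 𝒢 d) : E.symm x ∈ grading 𝒢 d := by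
  obtain ⟨y, hy, hyd⟩ := hE.exists_preimage x
  rw [← show y = E.symm x from (E.symm_apply_eq.2 hy.symm).symm]
  exact hyd d hx

theorem symm_comm {E : FormalSeries g ≃ₗ[K⟦X⟧] FormalSeries g} (hE : IsGauge 𝒢 α E.toLinearMap)
    (x : FormalSeries g) : E.symm (mapLin α x) = mapLin α (E.symm x) := by
  rw [E.symm_apply_eq]
  have := hE.comm (E.symm x)
  simpa using this.symm

/-- `1 + tᵖ h` is an admissible automorphism for every `h ∈ C¹(g, g)_0` and `p ≥ 1`. -/
theorem id_add_X_pow_smul {h : g →ₗ[K] g} (hh : h ∈ C1 𝒢 α 0) {p : ℕ} (hp : 1 ≤ p) :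
    IsGauge 𝒢 α (LinearMap.id + (PowerSeries.X : K⟦X⟧) ^ p • mapLin h) where
  even d x hx := add_mem hx (Submodule.smul_mem _ _ fun k => by
    have := hh.1 d _ (hx k)
    rwa [zero_add] at this)
  comm x := by
    have : mapLin h (mapLin α x) = mapLin α (mapLin h x) :=
      FormalSeries.ext fun k => hh.2 (coeff k x)
    simp [this]
  congr_id x := (CongrMod.add_X_pow_smul p x (mapLin h x)).mono hp

end IsGauge

/-! ### Transport of a deformation along an automorphism -/

/-- The `n`-linear map `E ∘ f ∘ (E⁻¹, …, E⁻¹)`. -/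
noncomputable def transport (E : FormalSeries g ≃ₗ[K⟦X⟧] FormalSeries g)
    (f : MultilinearMap K⟦X⟧ (fun _ : Fin (N + 1) => FormalSeries g) (FormalSeries g)) :
    MultilinearMap K⟦X⟧ (fun _ : Fin (N + 1) => FormalSeries g) (FormalSeries g) :=
  E.toLinearMap.compMultilinearMap (f.compLinearMap fun _ => E.symm.toLinearMap)

theorem transport_apply (E : FormalSeries g ≃ₗ[K⟦X⟧] FormalSeries g)
    (f : MultilinearMap K⟦X⟧ (fun _ : Fin (N + 1) => FormalSeries g) (FormalSeries g))
    (x : Fin (N + 1) → FormalSeries g) : transport E f x = E (f fun i => E.symm (x i)) := rfl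

theorem act_transport (E : FormalSeries g ≃ₗ[K⟦X⟧] FormalSeries g)
    (f : MultilinearMap K⟦X⟧ (fun _ : Fin (N + 1) => FormalSeries g) (FormalSeries g))
    (x : Fin N → FormalSeries g) (z : FormalSeries g) :
    act (transport E f) x z = E (act f (fun i => E.symm (x i)) (E.symm z)) := by
  rw [act, act, transport_apply]
  congr 2
  funext i
  refine Fin.lastCases ?_ (fun i => ?_) i <;> simp

theorem isMultHomNambuLieSuperalgebra_transport {𝒢 : ZMod 2 → Submodule K g} {α : g →ₗ[K] g}
    {E : FormalSeries g ≃ₗ[K⟦X⟧] FormalSeries g} (hE : IsGauge 𝒢 α E.toLinearMap)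
    {f : MultilinearMap K⟦X⟧ (fun _ : Fin (N + 1) => FormalSeries g) (FormalSeries g)}
    (hf : IsMultHomNambuLieSuperalgebra (grading 𝒢) f (mapLin α)) :
    IsMultHomNambuLieSuperalgebra (grading 𝒢) (transport E f) (mapLin α) where
  internal := hf.internal
  even_map := hf.even_map
  even_bracket a x hx := hE.even _ _ (hf.even_bracket a _ fun i => hE.symm_even (hx i))
  skew a x hx i := by
    have := hf.skew a _ (fun i => hE.symm_even (hx i)) i
    rw [transport_apply, transport_apply]
    refine (congrArg E this).trans ?_
    rw [map_neg]
    congr 1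
    exact map_zsmul E _ _
  multiplicative x := by
    have := hE.comm (f fun i => E.symm (x i))
    simp only [LinearEquiv.coe_coe] at this
    simp only [transport_apply, ← this, hf.multiplicative, hE.symm_comm]
  hom_nambu a b x y hx hy := by
    have := hf.hom_nambu a b _ _ (fun i => hE.symm_even (hx i)) (fun i => hE.symm_even (hy i))
    rw [act_transport, transport_apply, E.symm_apply_apply]
    simp only [hE.symm_comm]
    rw [this, map_sum]
    refine Finset.sum_congr rfl fun i _ => ?_
    rw [transport_apply, act_transport]
    refine (map_zsmul E _ _).trans ?_
    refine congrArg _ (congrArg E (congrArg f (funext fun j => ?_)))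
    by_cases hj : j = i
    · subst hj; simp
    · simp [hj, hE.symm_comm]

/-- Coefficients of a transported map only depend on the automorphism modulo a power of `t`. -/
theorem congrMod_transport {p : ℕ} {E E' : FormalSeries g ≃ₗ[K⟦X⟧] FormalSeries g}
    (h : ∀ x, CongrMod p (E x) (E' x))
    (f : MultilinearMap K⟦X⟧ (fun _ : Fin (N + 1) => FormalSeries g) (FormalSeries g))
    (x : Fin (N + 1) → FormalSeries g) : CongrMod p (transport E f x) (transport E' f x) := by
  refine (h _).trans (CongrMod.map E'.toLinearMap (CongrMod.map_multilinear f fun i => ?_))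
  have := CongrMod.map E'.symm.toLinearMap (h (E.symm (x i)))
  simpa using this.symm

/-! ### The coefficients of a deformation -/

/-- The `n`-linear map `fₚ` on `g` in the expansion `f_t = ∑ₚ fₚ tᵖ`. -/
noncomputable def coeffMap
    (f : MultilinearMap K⟦X⟧ (fun _ : Fin (N + 1) => FormalSeries g) (FormalSeries g)) (p : ℕ) :
    MultilinearMap K (fun _ : Fin (N + 1) => g) g where
  toFun x := coeff p (f fun i => const (x i))
  map_update_add' x i u v := by
    -- The field quantifies over every decidability instance, `const_update` uses the standard one.
    have := Subsingleton.elim ‹DecidableEq (Fin (N + 1))› (instDecidableEqFin (N + 1))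
    subst this
    simp only [const_update, const_add, f.map_update_add, coeff_add]
  map_update_smul' x i c u := by
    have := Subsingleton.elim ‹DecidableEq (Fin (N + 1))› (instDecidableEqFin (N + 1))
    subst this
    simp only [const_update, const_smul, f.map_update_smul, coeff_C_smul]

theorem coeffMap_apply
    (f : MultilinearMap K⟦X⟧ (fun _ : Fin (N + 1) => FormalSeries g) (FormalSeries g)) (p : ℕ)
    (x : Fin (N + 1) → g) : coeffMap f p x = coeff p (f fun i => const (x i)) := rfl

theorem coeffMap_mem_C2 {𝒢 : ZMod 2 → Submodule K g} {α : g →ₗ[K] g}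
    {f : MultilinearMap K⟦X⟧ (fun _ : Fin (N + 1) => FormalSeries g) (FormalSeries g)}
    (hs : IsMultHomNambuLieSuperalgebra (grading 𝒢) f (mapLin α)) (p : ℕ) :
    coeffMap f p ∈ C2 N 𝒢 α 0 := by
  refine ⟨fun a x hx => hs.even_bracket a _ (fun i => const_mem_grading (hx i)) p,
    fun a x hx i => ?_, fun x => ?_⟩
  · have := congrArg (coeff p) (hs.skew a _ (fun i => const_mem_grading (hx i)) i)
    rwa [coeff_neg, coeff_units_smul] at this
  · have := congrArg (coeff p) (hs.multiplicative fun i => const (x i))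
    simp only [mapLin_const] at this
    exact this.symm

theorem const_snoc {g : Type*} [AddCommGroup g] (x : Fin N → g) (z : g) :
    (fun i => const (Fin.snoc (α := fun _ => g) x z i)) =
      Fin.snoc (α := fun _ => FormalSeries g) (fun i => const (x i)) (const z) := by
  funext i
  refine Fin.lastCases ?_ (fun i => ?_) i <;> simp

theorem act_eq_update {R M : Type*} [CommRing R] [AddCommGroup M] [Module R M]
    (f : MultilinearMap R (fun _ : Fin (N + 1) => M) M) (x : Fin N → M) (z w : M) :
    act f x z = f (Function.update (Fin.snoc (α := fun _ => M) x w) (Fin.last N) z) := by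
  rw [act, Fin.update_snoc_last]

theorem map_snoc {g M : Type*} (α : g → M) (x : Fin N → g) (z : g) :
    (fun i => α (Fin.snoc (α := fun _ => g) x z i)) =
      Fin.snoc (α := fun _ => M) (fun i => α (x i)) (α z) := by
  funext i
  refine Fin.lastCases ?_ (fun i => ?_) i <;> simp

/-! ### Coboundaries of linear and of `n`-linear maps -/

/-- The coboundary of a linear map: `δ¹h`. -/
theorem coboundary_one (br : MultilinearMap K (fun _ : Fin (N + 1) => g) g) (α : g →ₗ[K] g)
    (d : ZMod 2) (h : g → g) (a : Fin 1 → Fin N → ZMod 2) (X : Fin 1 → Fin N → g) (z : g) :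
    coboundary br α d (fun (_ : Fin 0 → Fin N → g) w => h w) a X z =
      -h (act br (X 0) z) + (-1 : ℤˣ) ^ ((∑ s, a 0 s) * d) • act br (X 0) (h z) +
        ∑ s : Fin N, (-1 : ℤˣ) ^ (d * ∑ s' ∈ Iio s, a 0 s') •
          act br (Function.update (X 0) s (h (X 0 s))) z := by
  have h : Iio (0 : Fin (0 + 1)) = ∅ := rfl
  simp [coboundary, h]

/-- The coboundary of an `n`-linear map: `δ²f`. -/
theorem coboundary_two (br f : MultilinearMap K (fun _ : Fin (N + 1) => g) g) (α : g →ₗ[K] g)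
    (d : ZMod 2) (a : Fin 2 → Fin N → ZMod 2) (X : Fin 2 → Fin N → g) (z : g) :
    coboundary br α d (fun (Y : Fin 1 → Fin N → g) w => act f (Y 0) w) a X z =
      act f (fun s => α (X 0 s)) (act br (X 1) z) +
      (-1 : ℤˣ) ^ ((∑ s, a 0 s) * d) • act br (fun s => α (X 0 s)) (act f (X 1) z) -
      ((∑ s : Fin N, (-1 : ℤˣ) ^ ((∑ s', a 0 s') * ∑ s' ∈ Iio s, a 1 s') •
          act f (Function.update (fun s' => α (X 1 s')) s (act br (X 0) (X 1 s))) (α z)) +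
        (-1 : ℤˣ) ^ ((∑ s, a 0 s) * ∑ s, a 1 s) •
          act f (fun s => α (X 1 s)) (act br (X 0) z)) -
      ((∑ s : Fin N, (-1 : ℤˣ) ^ ((d + ∑ s', a 0 s') * ∑ s' ∈ Iio s, a 1 s') •
          act br (Function.update (fun s' => α (X 1 s')) s (act f (X 0) (X 1 s))) (α z)) +
        (-1 : ℤˣ) ^ ((∑ s, a 1 s) * (d + ∑ s, a 0 s)) •
          act br (fun s => α (X 1 s)) (act f (X 0) z)) := by
  have hs : ∀ F : Fin (1 + 1) → g, ∑ i, F i = F 0 + F 1 := fun F => Fin.sum_univ_two F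
  have h0 : Ioi (0 : Fin (1 + 1)) = {1} := rfl
  have h1 : Ioi (1 : Fin (1 + 1)) = ∅ := rfl
  have h2 : Iio (1 : Fin (1 + 1)) = {0} := rfl
  have h3 : Iio (0 : Fin (1 + 1)) = ∅ := rfl
  have h4 : Ioo (0 : Fin (1 + 1)) 1 = ∅ := rfl
  have e0 : (0 : Fin (1 + 1)).succAbove (0 : Fin 1) = 1 := rfl
  have e1 : (1 : Fin (1 + 1)).succAbove (0 : Fin 1) = 0 := rfl
  have e2 : Fin.last 1 = 1 := rfl
  simp only [coboundary, hs, h0, h1, h2, h3, h4, e0, e1, e2, Finset.sum_singleton,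
    Finset.sum_empty, Fin.sum_univ_one]
  simp
  abel

/-! ### The lowest nonzero coefficient is a cocycle -/

/-- `f_t = br + fₚ tᵖ + …`: the constant coefficient is `br` and `f₁, …, fₚ₋₁` vanish. -/
structure IsTrivialBelow (br : MultilinearMap K (fun _ : Fin (N + 1) => g) g)
    (f : MultilinearMap K⟦X⟧ (fun _ : Fin (N + 1) => FormalSeries g) (FormalSeries g)) (p : ℕ) :
    Prop where
  coeffMap_zero : coeffMap f 0 = br
  coeffMap_eq_zero : ∀ q, 1 ≤ q → q < p → coeffMap f q = 0

namespace IsTrivialBelow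

variable {𝒢 : ZMod 2 → Submodule K g} {α : g →ₗ[K] g}
  {br : MultilinearMap K (fun _ : Fin (N + 1) => g) g}
  {f : MultilinearMap K⟦X⟧ (fun _ : Fin (N + 1) => FormalSeries g) (FormalSeries g)} {p : ℕ}

theorem congrMod_const (hf : IsTrivialBelow br f p) (hp : 1 ≤ p) (x : Fin (N + 1) → g) :
    CongrMod (p + 1) (f fun i => const (x i))
      (const (br x) + (PowerSeries.X : K⟦X⟧) ^ p • const (coeffMap f p x)) := by
  intro k hk
  rw [coeff_add, coeff_X_pow_smul, coeff_const, coeff_const, ← coeffMap_apply]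
  rcases Nat.eq_zero_or_pos k with rfl | hk0
  · rw [if_pos rfl, if_neg (by omega), add_zero, hf.coeffMap_zero]
  · rw [if_neg (by omega), zero_add]
    rcases Nat.lt_or_ge k p with h | h
    · rw [if_neg (by omega), hf.coeffMap_eq_zero k hk0 h]
      rfl
    · obtain rfl : k = p := by omega
      simp

/-- The coefficient of `tᵖ` in `f_t(w₁, …, v₀ + tᵖ v₁, …, wₙ)`. -/
theorem coeff_update (hf : IsTrivialBelow br f p) (w : Fin (N + 1) → g)
    (i : Fin (N + 1)) {v : FormalSeries g} {v₀ v₁ : g}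
    (hv : CongrMod (p + 1) v (const v₀ + (PowerSeries.X : K⟦X⟧) ^ p • const v₁)) :
    coeff p (f (Function.update (fun j => const (w j)) i v)) =
      coeffMap f p (Function.update w i v₀) + br (Function.update w i v₁) := by
  have h : CongrMod (p + 1) (f (Function.update (fun j => const (w j)) i v))
      (f (Function.update (fun j => const (w j)) i
        (const v₀ + (PowerSeries.X : K⟦X⟧) ^ p • const v₁))) :=
    CongrMod.map_multilinear f fun j => by
      by_cases hj : j = i
      · subst hj; simpa using hv
      · simpa [hj] using CongrMod.refl _ _
  rw [h p (by omega), f.map_update_add, f.map_update_smul, coeff_add, coeff_X_pow_smul,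
    if_pos le_rfl, Nat.sub_self, ← const_update, ← const_update, ← coeffMap_apply,
    ← coeffMap_apply, hf.coeffMap_zero]

theorem coeff_act (hf : IsTrivialBelow br f p) (w : Fin N → g)
    {v : FormalSeries g} {v₀ v₁ : g}
    (hv : CongrMod (p + 1) v (const v₀ + (PowerSeries.X : K⟦X⟧) ^ p • const v₁)) :
    coeff p (act f (fun j => const (w j)) v) = act (coeffMap f p) w v₀ + act br w v₁ := by
  rw [act_eq_update f _ _ (const 0), ← const_snoc, hf.coeff_update _ _ hv,
    ← act_eq_update, ← act_eq_update]

/-- The coefficient of `tᵖ` in the Hom-Nambu identity. -/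
theorem hom_nambu_coeff (hs : IsMultHomNambuLieSuperalgebra (grading 𝒢) f (mapLin α))
    (hf : IsTrivialBelow br f p) (hp : 1 ≤ p) (a : Fin N → ZMod 2) (b : Fin (N + 1) → ZMod 2)
    (x : Fin N → g) (y : Fin (N + 1) → g) (hx : ∀ i, x i ∈ 𝒢 (a i)) (hy : ∀ i, y i ∈ 𝒢 (b i)) :
    act (coeffMap f p) (fun i => α (x i)) (br y) + act br (fun i => α (x i)) (coeffMap f p y) =
      ∑ i : Fin (N + 1), (-1 : ℤˣ) ^ ((∑ j, a j) * ∑ j ∈ Iio i, b j) •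
        (coeffMap f p (Function.update (fun j => α (y j)) i (act br x (y i))) +
          br (Function.update (fun j => α (y j)) i (act (coeffMap f p) x (y i)))) := by
  have h := congrArg (coeff p) (hs.hom_nambu a b _ _ (fun i => const_mem_grading (hx i))
    fun i => const_mem_grading (hy i))
  simp only [mapLin_const] at h
  rw [hf.coeff_act _ (hf.congrMod_const hp y), coeff_sum] at h
  rw [h]
  refine Finset.sum_congr rfl fun i _ => ?_
  rw [coeff_units_smul]
  congr 1
  refine hf.coeff_update _ _ ?_
  rw [act, ← const_snoc]
  exact hf.congrMod_const hp _

/-- The Hom-Nambu identity in order `tᵖ` says precisely that `δ²fₚ = 0`. -/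
theorem coeffMap_mem_Z2 (hs : IsMultHomNambuLieSuperalgebra (grading 𝒢) f (mapLin α))
    (hf : IsTrivialBelow br f p) (hp : 1 ≤ p) : coeffMap f p ∈ Z2 𝒢 br α 0 := by
  refine ⟨coeffMap_mem_C2 hs p, fun a b X z hX hz => ?_⟩
  have h := hf.hom_nambu_coeff hs hp (a 0) (Fin.snoc (α := fun _ => ZMod 2) (a 1) b) (X 0)
    (Fin.snoc (α := fun _ => g) (X 1) z) (hX 0)
    (Fin.lastCases (by simpa using hz) fun i => by simpa using hX 1 i)
  rw [Fin.sum_univ_castSucc] at h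
  have h1 : ∀ (s : Fin N) (v : g),
      Function.update (fun j => α (Fin.snoc (α := fun _ => g) (X 1) z j)) s.castSucc v =
        Fin.snoc (α := fun _ => g) (Function.update (fun j => α (X 1 j)) s v) (α z) := by
    intro s v
    rw [Fin.snoc_update, ← map_snoc]
  have h2 : ∀ v : g,
      Function.update (fun j => α (Fin.snoc (α := fun _ => g) (X 1) z j)) (Fin.last N) v =
        Fin.snoc (α := fun _ => g) (fun j => α (X 1 j)) v := by
    intro v
    rw [map_snoc, Fin.update_snoc_last]
  have h3 : ∀ s : Fin N, ∑ j ∈ Iio s.castSucc, Fin.snoc (α := fun _ => ZMod 2) (a 1) b j =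
      ∑ j ∈ Iio s, a 1 j := by
    intro s
    rw [← Fin.map_castSuccEmb_Iio, Finset.sum_map]
    simp
  have h4 : ∑ j ∈ Iio (Fin.last N), Fin.snoc (α := fun _ => ZMod 2) (a 1) b j = ∑ j, a 1 j := by
    rw [Fin.Iio_last_eq_map, Finset.sum_map]
    simp
  simp only [h1, h2, h3, h4, Fin.snoc_castSucc, Fin.snoc_last] at h
  rw [coboundary_two]
  simp only [act, zero_add, smul_add, Finset.sum_add_distrib] at h ⊢
  rw [mul_zero, uzpow_zero, one_smul, h, mul_comm (∑ s, a 1 s)]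
  abel

end IsTrivialBelow

/-! ### Removing the lowest nonzero coefficient -/

theorem multilinearMap_eq_zero_of_homogeneous {𝒢 : ZMod 2 → Submodule K g}
    (h𝒢 : DirectSum.IsInternal 𝒢) {φ : MultilinearMap K (fun _ : Fin (N + 1) => g) g}
    (h : ∀ (a : Fin (N + 1) → ZMod 2) (x : Fin (N + 1) → g), (∀ i, x i ∈ 𝒢 (a i)) → φ x = 0) :
    φ = 0 := by
  suffices H : ∀ (s : Finset (Fin (N + 1))) (x : Fin (N + 1) → g),
      (∀ i ∉ s, ∃ a, x i ∈ 𝒢 a) → φ x = 0 from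
    MultilinearMap.ext fun x => H univ x fun i hi => absurd (mem_univ i) hi
  intro s
  induction s using Finset.induction_on with
  | empty =>
    intro x hx
    choose a ha using fun i => hx i (notMem_empty i)
    exact h a x ha
  | insert j s hj ih =>
    intro x hx
    have key : ∀ v : g, φ (Function.update x j v) = 0 := by
      intro v
      have hv : v ∈ iSup 𝒢 := h𝒢.submodule_iSup_eq_top ▸ Submodule.mem_top
      induction hv using Submodule.iSup_induction' with
      | mem a v hv =>
        refine ih _ fun i hi => ?_
        by_cases hij : i = j
        · subst hij; exact ⟨a, by simpa using hv⟩
        · simpa [hij] using hx i (by simp [hij, hi])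
      | zero => exact φ.map_update_zero x j
      | add u v _ _ hu hv => rw [φ.map_update_add, hu, hv, add_zero]
    simpa using key (x j)

namespace IsTrivialBelow

variable {𝒢 : ZMod 2 → Submodule K g} {α : g →ₗ[K] g}
  {br : MultilinearMap K (fun _ : Fin (N + 1) => g) g}
  {f : MultilinearMap K⟦X⟧ (fun _ : Fin (N + 1) => FormalSeries g) (FormalSeries g)} {p : ℕ}

/-- The effect on the coefficients up to `tᵖ` of transport along `1 + tᵖ h`: only `fₚ` changes,
and it becomes `fₚ - δ¹h`. -/
theorem coeff_transport (hf : IsTrivialBelow br f p) (hp : 1 ≤ p)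
    {E : FormalSeries g ≃ₗ[K⟦X⟧] FormalSeries g} {h : g →ₗ[K] g}
    (hE : ∀ x, E x = x + (PowerSeries.X : K⟦X⟧) ^ p • mapLin h x) (x : Fin (N + 1) → g) :
    CongrMod (p + 1) (transport E f fun i => const (x i))
      (const (br x) + (PowerSeries.X : K⟦X⟧) ^ p • const (coeffMap f p x + h (br x) -
        ∑ i, br (Function.update x i (h (x i))))) := by
  have hsymm : ∀ v : g, CongrMod (p + 1) (E.symm (const v))
      (const v + (PowerSeries.X : K⟦X⟧) ^ p • const (-h v)) := by
    intro v
    have h1 : CongrMod (p + 1) (const v)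
        (E (const v + (PowerSeries.X : K⟦X⟧) ^ p • const (-h v))) := by
      intro k hk
      have h0 : const (-h v) + const (h v) = (0 : FormalSeries g) := by
        rw [← const_add, neg_add_cancel]; exact ext fun k => by simp [coeff_const, coeff_zero]
      rw [hE, map_add, map_smul, smul_add, add_assoc, ← add_assoc (_ • const (-h v)),
        mapLin_const, ← smul_add, h0, smul_zero, zero_add, coeff_add, smul_smul, ← pow_add,
        coeff_X_pow_smul, if_neg (by omega), add_zero]
    simpa using CongrMod.map E.symm.toLinearMap h1
  have h2 := (CongrMod.map_multilinear f fun i => hsymm (x i)).trans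
    ((congrMod_map_add_X_pow_smul f p (fun i => const (x i)) fun i => const (-h (x i))).mono
      (by omega))
  have h3 : CongrMod (p + 1) (f fun i => E.symm (const (x i)))
      (const (br x) + (PowerSeries.X : K⟦X⟧) ^ p •
        const (coeffMap f p x - ∑ i, br (Function.update x i (h (x i))))) := by
    refine h2.trans (((hf.congrMod_const hp x).add (CongrMod.refl _ _)).trans ?_)
    rw [add_assoc, ← smul_add]
    refine (CongrMod.refl _ _).add ?_
    rw [add_comm p 1]
    refine CongrMod.X_pow_smul p fun k hk => ?_
    obtain rfl : k = 0 := by omega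
    simp only [coeff_add, coeff_sum, coeff_zero_const, ← const_update, ← coeffMap_apply,
      hf.coeffMap_zero, MultilinearMap.map_update_neg, Finset.sum_neg_distrib, sub_eq_add_neg]
  refine (CongrMod.map E.toLinearMap h3).trans ?_
  rw [LinearEquiv.coe_coe, hE, add_assoc, ← smul_add]
  refine (CongrMod.refl _ _).add ?_
  rw [add_comm p 1]
  refine CongrMod.X_pow_smul p fun k hk => ?_
  obtain rfl : k = 0 := by omega
  simp only [coeff_add, coeff_mapLin, coeff_zero_const, coeff_X_pow_smul]
  rw [if_neg (by omega), add_zero]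
  abel

/-- If `H²(g, g)_0 = 0`, the coefficient of `tᵖ` can be removed by an automorphism that is the
identity modulo `tᵖ`. -/
theorem exists_gauge (h𝒢 : DirectSum.IsInternal 𝒢) (hZB : Z2 𝒢 br α 0 ≤ B2 𝒢 br α 0)
    (hs : IsMultHomNambuLieSuperalgebra (grading 𝒢) f (mapLin α))
    (hf : IsTrivialBelow br f p) (hp : 1 ≤ p) :
    ∃ E : FormalSeries g ≃ₗ[K⟦X⟧] FormalSeries g, IsGauge 𝒢 α E.toLinearMap ∧
      (∀ x, CongrMod p (E x) x) ∧ IsTrivialBelow br (transport E f) (p + 1) := by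
  obtain ⟨-, h, hh, hcob⟩ := hZB (hf.coeffMap_mem_Z2 hs hp)
  have hΦ := IsGauge.id_add_X_pow_smul hh hp
  let E := LinearEquiv.ofBijective _ hΦ.bijective
  have hE : ∀ x, E x = x + (PowerSeries.X : K⟦X⟧) ^ p • mapLin h x := fun _ => rfl
  have key := hf.coeff_transport hp hE
  refine ⟨E, hΦ, fun x => CongrMod.add_X_pow_smul p x _, ?_, fun q hq1 hq => ?_⟩
  · ext x
    rw [coeffMap_apply, key x 0 (by omega), coeff_add, coeff_X_pow_smul, if_neg (by omega),
      add_zero, coeff_zero_const]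
  · rcases Nat.lt_or_ge q p with hqp | hqp
    · ext x
      rw [coeffMap_apply, key x q (by omega), coeff_add, coeff_X_pow_smul, if_neg (by omega),
        add_zero, coeff_const, if_neg (by omega)]
      rfl
    · obtain rfl : q = p := by omega
      refine multilinearMap_eq_zero_of_homogeneous h𝒢 fun a x hx => ?_
      rw [coeffMap_apply, key x q (by omega), coeff_add, coeff_X_pow_smul, if_pos le_rfl,
        coeff_const, if_neg (by omega), Nat.sub_self, coeff_zero_const, zero_add]
      obtain ⟨y, z, rfl⟩ : ∃ (y : Fin N → g) (z : g), x = Fin.snoc (α := fun _ => g) y z :=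
        ⟨Fin.init x, x (Fin.last N), (Fin.snoc_init_self x).symm⟩
      have hc := hcob (fun _ i => a i.castSucc) (a (Fin.last N)) (fun _ => y) z
        (fun _ i => by simpa using hx i.castSucc) (by simpa using hx (Fin.last N))
      rw [coboundary_one] at hc
      simp only [act, mul_zero, zero_mul, uzpow_zero, one_smul] at hc
      rw [hc, Fin.sum_univ_castSucc]
      simp only [Fin.snoc_castSucc, Fin.snoc_last, Fin.update_snoc_last, ← Fin.snoc_update]
      abel

end IsTrivialBelow

/-! ### The limit of the successive corrections -/

/-- A sequence of admissible automorphisms in which `Φₙ₊₁ ≡ Φₙ` modulo `tⁿ⁺¹` converges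
`t`-adically. -/
theorem exists_limit_gauge {𝒢 : ZMod 2 → Submodule K g} {α : g →ₗ[K] g}
    (E : ℕ → FormalSeries g ≃ₗ[K⟦X⟧] FormalSeries g) (hE : ∀ n, IsGauge 𝒢 α (E n).toLinearMap)
    (hstep : ∀ n x, CongrMod (n + 1) (E (n + 1) x) (E n x)) :
    ∃ L : FormalSeries g ≃ₗ[K⟦X⟧] FormalSeries g, IsGauge 𝒢 α L.toLinearMap ∧
      ∀ n x, CongrMod (n + 1) (L x) (E n x) := by
  have hmono : ∀ n m x, CongrMod (n + 1) (E (n + m) x) (E n x) := by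
    intro n m x
    induction m with
    | zero => exact CongrMod.refl _ _
    | succ m ih => exact ((hstep (n + m) x).mono (by omega)).trans ih
  let l : FormalSeries g → FormalSeries g := fun x k => coeff k (E k x)
  have hl : ∀ n x, CongrMod (n + 1) (l x) (E n x) := by
    intro n x k hk
    obtain ⟨m, rfl⟩ := Nat.exists_eq_add_of_le (Nat.lt_succ_iff.1 hk)
    exact (hmono k m x k (by omega)).symm
  let Φ : FormalSeries g →ₗ[K⟦X⟧] FormalSeries g :=
    { toFun := l
      map_add' := fun x y => FormalSeries.ext fun k => by
        rw [coeff_add, hl k _ k (by omega), hl k _ k (by omega), hl k _ k (by omega), map_add,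
          coeff_add]
      map_smul' := fun c x => FormalSeries.ext fun k => by
        rw [hl k _ k (by omega), map_smul, RingHom.id_apply, coeff_smul, coeff_smul]
        refine Finset.sum_congr rfl fun q hq => ?_
        have := HasAntidiagonal.mem_antidiagonal.1 hq
        rw [hl k x q.2 (by omega)] }
  have hΦ : IsGauge 𝒢 α Φ :=
    { even := fun d x hx k => (hE k).even d x hx k
      comm := fun x => FormalSeries.ext fun k => by
        have := congrArg (coeff k) ((hE k).comm x)
        exact this
      congr_id := fun x => (hl 0 x).trans ((hE 0).congr_id x) }
  exact ⟨LinearEquiv.ofBijective Φ hΦ.bijective, hΦ, hl⟩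

end HomNambuLie

theorem theorem3p6 {K g : Type*} [Field K] [AddCommGroup g] [Module K g] {N : ℕ}
    (𝒢 : ZMod 2 → Submodule K g) (br : MultilinearMap K (fun _ : Fin (N + 1) => g) g)
    (α : g →ₗ[K] g) (hg : HomNambuLie.IsMultHomNambuLieSuperalgebra 𝒢 br α)
    (hH2 : Subsingleton (HomNambuLie.H2 𝒢 br α)) :
    HomNambuLie.AnalyticallyRigid 𝒢 br α := by
  open HomNambuLie HomNambuLie.FormalSeries in
  intro f hf
  have hZB : Z2 𝒢 br α 0 ≤ B2 𝒢 br α 0 := by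
    have : Subsingleton (H2Part 𝒢 br α 0) :=
      (Function.surjective_eval (β := H2Part 𝒢 br α) 0).subsingleton
    intro φ hφ
    have : (⟨φ, hφ⟩ : Z2 𝒢 br α 0) ∈ (B2 𝒢 br α 0).submoduleOf (Z2 𝒢 br α 0) :=
      (Submodule.Quotient.mk_eq_zero _).1 (Subsingleton.elim _ _)
    exact this
  have h0 : IsTrivialBelow br f 1 :=
    ⟨MultilinearMap.ext hf.coeff_zero, fun q h1 h2 => absurd h1 (by omega)⟩
  -- `E n` is an automorphism that kills the coefficients of `t¹, …, tⁿ`.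
  let P : ℕ → (FormalSeries g ≃ₗ[PowerSeries K] FormalSeries g) → Prop := fun n E =>
    IsGauge 𝒢 α E.toLinearMap ∧ IsTrivialBelow br (transport E f) (n + 1)
  have hnext : ∀ n (E : { E // P n E }), ∃ E' : { E' // P (n + 1) E' },
      ∀ x, CongrMod (n + 1) (E'.1 x) (E.1 x) := by
    rintro n ⟨E, hE, hT⟩
    obtain ⟨E', hE', hc, hT'⟩ := hT.exists_gauge hg.internal hZB
      (isMultHomNambuLieSuperalgebra_transport hE hf.superalgebra) (by omega)
    exact ⟨⟨E.trans E', hE'.comp hE, hT'⟩, fun x => hc (E x)⟩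
  choose next hnext using hnext
  let S : ∀ n, { E // P n E } := fun n =>
    Nat.rec ⟨LinearEquiv.refl _ _, ⟨fun _ _ h => h, fun _ => rfl, fun _ => CongrMod.refl _ _⟩, h0⟩
      next n
  obtain ⟨L, hL, hLS⟩ := exists_limit_gauge (fun n => (S n).1) (fun n => (S n).2.1)
    fun n => hnext n (S n)
  have hcoeff : ∀ p (x : Fin (N + 1) → g), coeff p (transport L f fun i => const (x i)) =
      coeffMap (transport (S p).1 f) p x :=
    fun p x => congrMod_transport (hLS p) f _ p (by omega)
  refine ⟨transport L f, ⟨⟨isMultHomNambuLieSuperalgebra_transport hL hf.superalgebra,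
    fun x => ?_⟩, fun p hp x => ?_⟩, L, hL.even, fun x => hL.congr_id _ 0 one_pos, hL.comm,
    fun x => ?_⟩
  · rw [hcoeff, (S 0).2.2.coeffMap_zero]
  · rw [hcoeff, (S p).2.2.coeffMap_eq_zero p hp (by omega)]
    rfl
  · simp [transport_apply]
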